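/- Let $X$ be a compact metric space, $T:X\to X$ a homeomorphism, and $\mu$ an ergodic $T$-invariant Borel probability measure on $X$. For a continuous map $A:X\to GL(2,\mathbb{R})$ and $n\ge 1$ put $A^0(x)=A^{-0}(x)=\mathrm{Id}$, $$A^n(x)=A(T^{n-1}x)\cdots A(Tx)A(x),\qquad A^{-n}(x)=A(T^{-n}x)^{-1}\cdots A(T^{-1}x)^{-1}.$$ The cocycle generated by $A$ over $T$ is said to have dominated splitting if there is a continuous decomposition $\mathbb{R}^2=E(x)\oplus F(x)$, $x\in X$, such that for every $x\in X$: (1) $\dim E(x)=\dim F(x)=1$; (2) $A(x)E(x)=E(Tx)$ and $A(x)F(x)=F(Tx)$; (3) there exists $l\ge 1$ with $$\|A^l(x)|_{E(x)}\|\cdot\|A^{-l}(T^lx)|_{F(T^lx)}\|<\tfrac12,$$ where the norms are the operator norms induced by the Euclidean norm of $\mathbb{R}^2$. Assume that $A:X\to GL(2,\mathbb{R})$ is continuous, that $\det A(x)>0$ for every $x\in X$, and that the cocycle $A$ has dominated splitting. For $\theta\in\mathbb{R}$ let $R_\theta$ be the rotation of angle $\theta$, let $A_\theta(x)=A(x)R_\theta$,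 and let $\mathcal{U}\subseteq\mathbb{R}$ be the set of all $\theta$ for which the cocycle $A_\theta$ has dominated splitting. Then the set $\mathbb{R}\setminus\mathcal{U}$ is nonempty, and for every $\theta\in\mathbb{R}\setminus\mathcal{U}$ the cocycle $A_\theta$ does not have dominated splitting. -/

import Mathlib

open scoped MatrixGroups

/-- The plane with its Euclidean norm. -/
abbrev Plane : Type := EuclideanSpace ℝ (Fin 2)

/-- The linear action of a matrix in `GL(2, ℝ)` on the Euclidean plane, as a bounded operator. -/
noncomputable def planeMap (M : GL (Fin 2) ℝ) : Plane →L[ℝ] Plane :=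
  Matrix.toEuclideanCLM (n := Fin 2) (𝕜 := ℝ) (M : Matrix (Fin 2) (Fin 2) ℝ)

/-- The forward iterates `A^n(x) = A(T^{n-1}x) ⋯ A(Tx) A(x)`, with `A^0(x) = Id`. -/
def cocycleIter {X : Type*} [TopologicalSpace X] (T : X ≃ₜ X) (A : X → GL (Fin 2) ℝ) :
    ℕ → X → GL (Fin 2) ℝ
  | 0, _ => 1
  | n + 1, x => A (T^[n] x) * cocycleIter T A n x

/-- The backward iterates `A^{-n}(x) = A(T^{-n}x)⁻¹ ⋯ A(T^{-1}x)⁻¹`, with `A^0(x) = Id`. -/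
def cocycleIterNeg {X : Type*} [TopologicalSpace X] (T : X ≃ₜ X) (A : X → GL (Fin 2) ℝ) :
    ℕ → X → GL (Fin 2) ℝ
  | 0, _ => 1
  | n + 1, x => (A (T.symm^[n + 1] x))⁻¹ * cocycleIterNeg T A n x

/-- The norm `‖M|V‖` of the restriction of `M` to a subspace `V` of the Euclidean plane. -/
noncomputable def restrictNorm (M : GL (Fin 2) ℝ) (V : Submodule ℝ Plane) : ℝ :=
  ‖(planeMap M).comp V.subtypeL‖

/-- A family of subspaces is continuous if the orthogonal projections onto them depend
continuously, in operator norm, on the base point. -/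
def ContinuousSubspaces {X : Type*} [TopologicalSpace X] (V : X → Submodule ℝ Plane) : Prop :=
  Continuous fun x => (V x).starProjection

/-- The cocycle generated by `A` over `T` has dominated splitting: there is a continuous
invariant decomposition `ℝ² = E(x) ⊕ F(x)` into lines such that `F` dominates `E`. -/
def HasDominatedSplitting {X : Type*} [TopologicalSpace X] (T : X ≃ₜ X)
    (A : X → GL (Fin 2) ℝ) : Prop :=
  ∃ E F : X → Submodule ℝ Plane,
    ContinuousSubspaces E ∧ ContinuousSubspaces F ∧
    ∀ x : X,
      IsCompl (E x) (F x) ∧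
      Module.finrank ℝ (E x) = 1 ∧ Module.finrank ℝ (F x) = 1 ∧
      (E x).map (planeMap (A x)).toLinearMap = E (T x) ∧
      (F x).map (planeMap (A x)).toLinearMap = F (T x) ∧
      ∃ l : ℕ, 1 ≤ l ∧
        restrictNorm (cocycleIter T A l x) (E x) *
          restrictNorm (cocycleIterNeg T A l (T^[l] x)) (F (T^[l] x)) < 1 / 2

/-- The rotation `R_θ` of angle `θ`. -/
noncomputable def rotationGL (θ : ℝ) : GL (Fin 2) ℝ :=
  Matrix.GeneralLinearGroup.mkOfDetNeZero
    !![Real.cos θ, -Real.sin θ; Real.sin θ, Real.cos θ]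
    (by rw [Matrix.det_fin_two_of]; nlinarith [Real.sin_sq_add_cos_sq θ])

/-- The rotated cocycle `A_θ(x) = A(x) R_θ`. -/
noncomputable def rotatedCocycle {X : Type*} (A : X → GL (Fin 2) ℝ) (θ : ℝ) :
    X → GL (Fin 2) ℝ :=
  fun x => A x * rotationGL θ

/-- The set `𝒰` of all parameters `θ` for which `A_θ` has dominated splitting. -/
def dominationSet {X : Type*} [TopologicalSpace X] (T : X ≃ₜ X) (A : X → GL (Fin 2) ℝ) :
    Set ℝ :=
  {θ : ℝ | HasDominatedSplitting T (rotatedCocycle A θ)}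

/-!
The second assertion is the definition of the set of parameters. For the first one, suppose that
`A_θ` has dominated splitting for every `θ`; this is contradicted by counting turns.

Since `det A > 0`, the action of each `A(y)` on directions lifts to an increasing map `a_y` of the
line of angles with `a_y(s + π) = a_y(s) + π` (`exists_isAngleLift`). Fix a point `x` and let
`g_n(θ)` be the angle that the `n`-th iterate of `A_θ` along the orbit of `x` assigns to the angle
`0`. As `R_π = -Id` adds a half-turn in each step, `g_n(π) = g_n(0) + nπ`
(`angleIter_param_pi`).

On the other hand, domination is robust. If `A_θ₀` has a dominated splitting `E ⊕ F`, then the cone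
around `F` of vectors whose `E`-component is not longer than their `F`-component is mapped strictly
inside itself after a bounded time. By compactness of `X` and of the unit circle this persists, with
the same times, for all `θ` near `θ₀` (`IsDominatedSplitting.exists_uniform_cone_step`). So the
image of the line `F(x)` under the iterates of `A_θ` stays off `E` at times with bounded gaps, for
all these `θ` at once, and by the intermediate value theorem its angle moves by less than `π` as
`θ` varies near `θ₀`. Hence `g_n(θ) - g_n(θ₀)` is bounded uniformly in `n`
(`eventually_bounded_angleIter_sub`). Being at bounded distance in this sense is an equivalence
relation between parameters, now with open classes; `ℝ` is connected, so the parameters `0` and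
`π` are equivalent, which is absurd because `g_n(π) - g_n(0) = nπ`.
-/

open Filter Topology

/-! ### Directions and angles in the plane -/

/-- The unit vector of the plane at angle `s` from the first coordinate axis. -/
noncomputable def dir (s : ℝ) : Plane := !₂[Real.cos s, Real.sin s]

lemma norm_dir (s : ℝ) : ‖dir s‖ = 1 := by
  rw [EuclideanSpace.norm_eq]
  simp [dir, Fin.sum_univ_two]

lemma dir_ne_zero (s : ℝ) : dir s ≠ 0 := by
  rw [← norm_ne_zero_iff, norm_dir]
  exact one_ne_zero

lemma dir_add_int_mul_pi (s : ℝ) (k : ℤ) :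
    dir (s + k * Real.pi) = ((-1 : ℝ) ^ k) • dir s := by
  ext i
  fin_cases i
  · simp [dir, Real.cos_add_int_mul_pi]
  · simp [dir, Real.sin_add_int_mul_pi]

lemma exists_dir_eq {v : Plane} (hv : ‖v‖ = 1) : ∃ s, |s| ≤ Real.pi ∧ dir s = v := by
  set z : ℂ := ⟨v 0, v 1⟩ with hz
  have hzn : ‖z‖ = 1 := by
    have h1 : ‖v‖ ^ 2 = v 0 ^ 2 + v 1 ^ 2 := by
      rw [EuclideanSpace.norm_sq_eq]; simp [Fin.sum_univ_two]
    have h2 : ‖z‖ ^ 2 = v 0 ^ 2 + v 1 ^ 2 := by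
      rw [← Complex.normSq_eq_norm_sq, Complex.normSq_apply, hz]; ring
    have h3 : ‖z‖ ^ 2 = 1 := by rw [h2, ← h1, hv]; norm_num
    nlinarith [norm_nonneg z]
  refine ⟨z.arg, Complex.abs_arg_le_pi z, ?_⟩
  have hc := Complex.norm_mul_cos_arg z
  have hs := Complex.norm_mul_sin_arg z
  rw [hzn, one_mul] at hc hs
  ext i
  fin_cases i
  · simpa [dir] using hc
  · simpa [dir] using hs

lemma planeMap_one (v : Plane) : planeMap 1 v = v := by
  simp [planeMap]

lemma planeMap_mul (M N : GL (Fin 2) ℝ) (v : Plane) :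
    planeMap (M * N) v = planeMap M (planeMap N v) := by
  simp [planeMap]

lemma planeMap_inv_apply (M : GL (Fin 2) ℝ) (v : Plane) :
    planeMap M⁻¹ (planeMap M v) = v := by
  rw [← planeMap_mul, inv_mul_cancel, planeMap_one]

lemma planeMap_ne_zero (M : GL (Fin 2) ℝ) {v : Plane} (hv : v ≠ 0) : planeMap M v ≠ 0 := by
  intro h
  apply hv
  rw [← planeMap_inv_apply M v, h, map_zero]

lemma planeMap_rotationGL_dir (θ s : ℝ) : planeMap (rotationGL θ) (dir s) = dir (s + θ) := by
  ext i
  fin_cases i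
  · simp [planeMap, rotationGL, dir, Matrix.toEuclideanCLM_toLp,
      Matrix.GeneralLinearGroup.mkOfDetNeZero, Real.cos_add]
    ring
  · simp [planeMap, rotationGL, dir, Matrix.toEuclideanCLM_toLp,
      Matrix.GeneralLinearGroup.mkOfDetNeZero, Real.sin_add]
    ring

lemma dir_eq_of_smul_eq {r r' s s' : ℝ} (hr : 0 < r) (hr' : 0 < r')
    (h : r • dir s = r' • dir s') : dir s = dir s' := by
  have hn := congrArg norm h
  rw [norm_smul, norm_smul, norm_dir, norm_dir, mul_one, mul_one, Real.norm_of_nonneg hr.le,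
    Real.norm_of_nonneg hr'.le] at hn
  rw [hn] at h
  exact smul_right_injective _ hr'.ne' h

lemma exists_int_of_dir_eq {s s' : ℝ} (h : dir s = dir s') :
    ∃ k : ℤ, s = s' + k * (2 * Real.pi) := by
  have h0 : Real.cos s = Real.cos s' := by simpa [dir] using congrArg (fun v : Plane ↦ v 0) h
  have h1 : Real.sin s = Real.sin s' := by simpa [dir] using congrArg (fun v : Plane ↦ v 1) h
  have h2 : (s : Real.Angle) = s' := Real.Angle.cos_sin_inj h0 h1
  obtain ⟨k, hk⟩ := Real.Angle.angle_eq_iff_two_pi_dvd_sub.1 h2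
  exact ⟨k, by linarith⟩

/-! ### Lifting the action of a matrix to angles -/

/-- `a` describes the action of `M` on angles: it is a continuous lift to the real line of the
circle map induced by `M` on directions, it has degree one, and it stays within bounded distance
of a translation. -/
structure IsAngleLift (M : GL (Fin 2) ℝ) (a : ℝ → ℝ) : Prop where
  continuous : Continuous a
  add_pi : ∀ s, a (s + Real.pi) = a s + Real.pi
  near_translation : ∃ c, ∀ s, |a s - s - c| ≤ Real.pi
  apply_dir : ∀ s, ∃ r : ℝ, 0 < r ∧ planeMap M (dir s) = r • dir (a s)

namespace IsAngleLift

variable {M : GL (Fin 2) ℝ} {a : ℝ → ℝ}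

lemma add_nat_mul_pi (ha : IsAngleLift M a) (s : ℝ) (n : ℕ) :
    a (s + n * Real.pi) = a s + n * Real.pi := by
  induction n with
  | zero => simp
  | succ n ih =>
    rw [Nat.cast_succ, add_mul, one_mul, ← add_assoc, ha.add_pi, ih, add_assoc]

lemma add_int_mul_pi (ha : IsAngleLift M a) (s : ℝ) (k : ℤ) :
    a (s + k * Real.pi) = a s + k * Real.pi := by
  obtain ⟨n, rfl | rfl⟩ := k.eq_nat_or_neg
  · exact_mod_cast ha.add_nat_mul_pi s n
  · have := ha.add_nat_mul_pi (s + ((-n : ℤ) : ℝ) * Real.pi) n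
    push_cast at this ⊢
    rw [show s + -(n : ℝ) * Real.pi + n * Real.pi = s by ring] at this
    linarith

lemma injective (ha : IsAngleLift M a) : Function.Injective a := by
  intro s s' h
  obtain ⟨r, hr, h1⟩ := ha.apply_dir s
  obtain ⟨r', hr', h2⟩ := ha.apply_dir s'
  have h3 : planeMap M (r' • dir s) = planeMap M (r • dir s') := by
    rw [map_smul, map_smul, h1, h2, h, smul_smul, smul_smul, mul_comm]
  have h4 : r' • dir s = r • dir s' := by
    rw [← planeMap_inv_apply M (r' • dir s), h3, planeMap_inv_apply]
  obtain ⟨k, hk⟩ := exists_int_of_dir_eq (dir_eq_of_smul_eq hr' hr h4)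
  have h5 := ha.add_int_mul_pi s' (2 * k)
  push_cast at h5
  rw [show s' + 2 * (k : ℝ) * Real.pi = s by rw [hk]; ring, h] at h5
  rw [hk]
  linarith

lemma monotone (ha : IsAngleLift M a) : Monotone a := by
  rcases ha.continuous.strictMono_of_inj ha.injective with h | h
  · exact h.monotone
  · have h1 := h (show (0 : ℝ) < 0 + Real.pi by linarith [Real.pi_pos])
    rw [ha.add_pi] at h1
    linarith [Real.pi_pos]

end IsAngleLift

/-- In complex notation a real matrix is `z ↦ α z + β z̄`, with determinant `|α|² - |β|²`. If this
is positive, then `α e^{is} + β e^{-is} = α e^{is} (1 + (β / α) e^{-2is})`, where the last factor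
lies in the right half-plane and thus has a continuous argument. -/
lemma exists_isAngleLift (M : GL (Fin 2) ℝ) (hM : 0 < (M : Matrix (Fin 2) (Fin 2) ℝ).det) :
    ∃ a, IsAngleLift M a := by
  set m : Matrix (Fin 2) (Fin 2) ℝ := (M : Matrix (Fin 2) (Fin 2) ℝ) with hm
  set α : ℂ := ⟨(m 0 0 + m 1 1) / 2, (m 1 0 - m 0 1) / 2⟩ with hα
  set β : ℂ := ⟨(m 0 0 - m 1 1) / 2, (m 1 0 + m 0 1) / 2⟩ with hβ
  have hlt : ‖β‖ < ‖α‖ := by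
    rw [Matrix.det_fin_two] at hM
    have h1 : ‖β‖ ^ 2 < ‖α‖ ^ 2 := by
      rw [← Complex.normSq_eq_norm_sq, ← Complex.normSq_eq_norm_sq, Complex.normSq_apply,
        Complex.normSq_apply, hα, hβ]
      simp only
      nlinarith
    exact lt_of_pow_lt_pow_left₀ 2 (norm_nonneg _) h1
  have hα0 : α ≠ 0 := norm_pos_iff.1 ((norm_nonneg _).trans_lt hlt)
  set w : ℝ → ℂ := fun s ↦ 1 + β / α * Complex.exp (-(2 * s) * Complex.I) with hw
  have hwre : ∀ s, 0 < (w s).re := by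
    intro s
    have h1 : ‖β / α * Complex.exp (-(2 * s) * Complex.I)‖ < 1 := by
      rw [norm_mul, show (-(2 * s) * Complex.I : ℂ) = ((-(2 * s) : ℝ) : ℂ) * Complex.I by
        push_cast; ring, Complex.norm_exp_ofReal_mul_I, mul_one, norm_div]
      exact (div_lt_one (norm_pos_iff.2 hα0)).2 hlt
    have h2 := neg_abs_le (β / α * Complex.exp (-(2 * s) * Complex.I)).re
    have h3 := Complex.abs_re_le_norm (β / α * Complex.exp (-(2 * s) * Complex.I))
    simp only [hw, Complex.add_re, Complex.one_re]
    linarith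
  have hw0 : ∀ s, w s ≠ 0 := fun s h ↦ by
    have := hwre s
    rw [h] at this
    simp at this
  have hwc : Continuous w := by fun_prop
  refine ⟨fun s ↦ α.arg + s + (w s).arg, ?_, ?_, ⟨α.arg, ?_⟩, ?_⟩
  · refine (continuous_const.add continuous_id).add (continuous_iff_continuousAt.2 fun s ↦ ?_)
    exact (Complex.continuousAt_arg (Or.inl (hwre s))).comp hwc.continuousAt
  · intro s
    have : w (s + Real.pi) = w s := by
      simp only [hw]
      rw [show (-(2 * ((s + Real.pi : ℝ) : ℂ)) * Complex.I : ℂ)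
        = -(2 * s) * Complex.I - 2 * Real.pi * Complex.I by push_cast; ring,
        Complex.exp_periodic.sub_eq]
    rw [this]
    ring
  · intro s
    rw [show α.arg + s + (w s).arg - s - α.arg = (w s).arg by ring]
    exact Complex.abs_arg_le_pi _
  · intro s
    refine ⟨‖α‖ * ‖w s‖, mul_pos (norm_pos_iff.2 hα0) (norm_pos_iff.2 (hw0 s)), ?_⟩
    have key : ((‖α‖ * ‖w s‖ : ℝ) : ℂ)
          * Complex.exp (((α.arg + s + (w s).arg : ℝ) : ℂ) * Complex.I)
        = α * Complex.exp (s * Complex.I) + β * Complex.exp (-s * Complex.I) := by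
      have h1 := Complex.norm_mul_exp_arg_mul_I α
      have h2 := Complex.norm_mul_exp_arg_mul_I (w s)
      calc _ = (‖α‖ * Complex.exp (α.arg * Complex.I)) * Complex.exp (s * Complex.I)
            * (‖w s‖ * Complex.exp ((w s).arg * Complex.I)) := by
            push_cast
            rw [show ((α.arg : ℂ) + s + (w s).arg) * Complex.I
              = α.arg * Complex.I + s * Complex.I + (w s).arg * Complex.I by ring,
              Complex.exp_add, Complex.exp_add]
            ring
        _ = _ := by
            rw [h1, h2]
            simp only [hw]
            rw [show (-s * Complex.I : ℂ) = s * Complex.I + -(2 * s) * Complex.I by ring,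
              Complex.exp_add]
            field_simp
    have hre := congrArg Complex.re key
    have him := congrArg Complex.im key
    rw [show (-s * Complex.I : ℂ) = ((-s : ℝ) : ℂ) * Complex.I by push_cast; ring] at hre him
    simp only [Complex.mul_re, Complex.mul_im, Complex.add_re, Complex.add_im, Complex.ofReal_re,
      Complex.ofReal_im, Complex.exp_ofReal_mul_I_re, Complex.exp_ofReal_mul_I_im, hα, hβ,
      Real.cos_neg, Real.sin_neg] at hre him
    ext i
    fin_cases i
    · simp [planeMap, dir, Matrix.toEuclideanCLM_toLp, ← hm]
      linear_combination -hre
    · simp [planeMap, dir, Matrix.toEuclideanCLM_toLp, ← hm]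
      linear_combination -him

/-! ### Iterates of the cocycle -/

lemma planeMap_rotatedCocycle_dir {X : Type*} (A : X → GL (Fin 2) ℝ) (x : X) (θ s : ℝ) :
    planeMap (rotatedCocycle A θ x) (dir s) = planeMap (A x) (dir (s + θ)) := by
  rw [rotatedCocycle, planeMap_mul, planeMap_rotationGL_dir]

lemma restrictNorm_nonneg (M : GL (Fin 2) ℝ) (V : Submodule ℝ Plane) : 0 ≤ restrictNorm M V :=
  norm_nonneg ((planeMap M).comp V.subtypeL)

lemma norm_planeMap_le_restrictNorm (M : GL (Fin 2) ℝ) {V : Submodule ℝ Plane} {v : Plane}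
    (hv : v ∈ V) : ‖planeMap M v‖ ≤ restrictNorm M V * ‖v‖ :=
  ((planeMap M).comp V.subtypeL).le_opNorm ⟨v, hv⟩

lemma continuous_toEuclideanCLM : Continuous
    (Matrix.toEuclideanCLM (n := Fin 2) (𝕜 := ℝ)) :=
  (Matrix.toEuclideanCLM (n := Fin 2) (𝕜 := ℝ)).toAlgEquiv.toLinearMap.continuous_of_finiteDimensional

section Cocycle

variable {X : Type*} [TopologicalSpace X] (T : X ≃ₜ X) (A : X → GL (Fin 2) ℝ)

lemma cocycleIter_add (m l : ℕ) (x : X) :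
    cocycleIter T A (m + l) x = cocycleIter T A l (T^[m] x) * cocycleIter T A m x := by
  induction l with
  | zero => simp [cocycleIter]
  | succ l ih =>
    rw [← add_assoc, cocycleIter, ih, cocycleIter, mul_assoc, ← Function.iterate_add_apply,
      add_comm l m]

lemma cocycleIterNeg_iterate (n : ℕ) (x : X) :
    cocycleIterNeg T A n (T^[n] x) = (cocycleIter T A n x)⁻¹ := by
  induction n generalizing x with
  | zero => simp [cocycleIter, cocycleIterNeg]
  | succ n ih =>
    have hT : T.symm^[n + 1] (T^[n + 1] x) = x :=
      (T.left_inv.iterate (n + 1)) x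
    rw [cocycleIterNeg, hT, Function.iterate_succ_apply, ih, add_comm n 1, cocycleIter_add,
      mul_inv_rev]
    simp [cocycleIter]

lemma map_cocycleIter {V : X → Submodule ℝ Plane}
    (hV : ∀ x, (V x).map (planeMap (A x)).toLinearMap = V (T x)) (n : ℕ) {x : X} {v : Plane}
    (hv : v ∈ V x) : planeMap (cocycleIter T A n x) v ∈ V (T^[n] x) := by
  induction n with
  | zero => simpa [cocycleIter, planeMap_one] using hv
  | succ n ih =>
    rw [cocycleIter, planeMap_mul, Function.iterate_succ_apply', ← hV]
    exact Submodule.mem_map_of_mem ih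

variable {A} in
lemma continuous_cocycleIter_rotatedCocycle (hA : Continuous A) (n : ℕ) :
    Continuous fun p : X × ℝ ↦
      (cocycleIter T (rotatedCocycle A p.2) n p.1 : Matrix (Fin 2) (Fin 2) ℝ) := by
  induction n with
  | zero => exact continuous_const
  | succ n ih =>
    have h1 : Continuous fun θ : ℝ ↦ (rotationGL θ : Matrix (Fin 2) (Fin 2) ℝ) := by
      change Continuous fun θ : ℝ ↦ !![Real.cos θ, -Real.sin θ; Real.sin θ, Real.cos θ]
      refine continuous_matrix fun i j ↦ ?_
      fin_cases i <;> fin_cases j <;> simp <;> fun_prop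
    have h2 : Continuous fun p : X × ℝ ↦ (A (T^[n] p.1) : Matrix (Fin 2) (Fin 2) ℝ) :=
      Units.continuous_val.comp (hA.comp ((T.continuous.iterate n).comp continuous_fst))
    simp only [cocycleIter, rotatedCocycle, Units.val_mul]
    exact (h2.mul (h1.comp continuous_snd)).mul ih

variable {A} in
lemma continuous_planeMap_cocycleIter_rotatedCocycle (hA : Continuous A) (n : ℕ) :
    Continuous fun p : X × ℝ ↦ planeMap (cocycleIter T (rotatedCocycle A p.2) n p.1) :=
  continuous_toEuclideanCLM.comp (continuous_cocycleIter_rotatedCocycle T hA n)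

/-- `E` and `F` are the dominated and the dominating line field of a dominated splitting of the
cocycle generated by `A`. -/
def IsDominatedSplitting (E F : X → Submodule ℝ Plane) : Prop :=
  ContinuousSubspaces E ∧ ContinuousSubspaces F ∧
    ∀ x : X,
      IsCompl (E x) (F x) ∧
      Module.finrank ℝ (E x) = 1 ∧ Module.finrank ℝ (F x) = 1 ∧
      (E x).map (planeMap (A x)).toLinearMap = E (T x) ∧
      (F x).map (planeMap (A x)).toLinearMap = F (T x) ∧
      ∃ l : ℕ, 1 ≤ l ∧
        restrictNorm (cocycleIter T A l x) (E x) *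
          restrictNorm (cocycleIterNeg T A l (T^[l] x)) (F (T^[l] x)) < 1 / 2

end Cocycle

/-! ### Cones between two transverse lines -/

lemma exists_unit_span_of_finrank_eq_one {V : Submodule ℝ Plane}
    (hV : Module.finrank ℝ V = 1) : ∃ u : Plane, ‖u‖ = 1 ∧ V = ℝ ∙ u := by
  obtain ⟨v, hv, h⟩ := finrank_eq_one_iff'.1 hV
  have hv0 : ‖(v : Plane)‖ ≠ 0 := by simpa using hv
  refine ⟨(‖(v : Plane)‖⁻¹ : ℝ) • (v : Plane), ?_, le_antisymm (fun w hw ↦ ?_) ?_⟩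
  · rw [norm_smul, norm_inv, norm_norm, inv_mul_cancel₀ hv0]
  · obtain ⟨c, hc⟩ := h ⟨w, hw⟩
    refine Submodule.mem_span_singleton.2 ⟨c * ‖(v : Plane)‖, ?_⟩
    rw [smul_smul, mul_assoc, mul_inv_cancel₀ hv0, mul_one]
    exact congrArg Subtype.val hc
  · rw [Submodule.span_singleton_le_iff_mem]
    exact V.smul_mem _ v.2

/-- The difference of the distances of `v` to the subspaces `E` and `F`. For transverse lines it
is nonnegative exactly on the cone of vectors whose `E`-component is at most as long as their
`F`-component. -/
noncomputable def coneGap (E F : Submodule ℝ Plane) (v : Plane) : ℝ :=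
  ‖v - E.starProjection v‖ - ‖v - F.starProjection v‖

/-- The constant is the sine of the angle between the two lines. -/
lemma exists_coneGap_add_eq {E F : Submodule ℝ Plane} (hE : Module.finrank ℝ E = 1)
    (hF : Module.finrank ℝ F = 1) (hEF : Disjoint E F) :
    ∃ c : ℝ, 0 < c ∧ ∀ e ∈ E, ∀ f ∈ F, coneGap E F (e + f) = c * (‖f‖ - ‖e‖) := by
  obtain ⟨u, hu, rfl⟩ := exists_unit_span_of_finrank_eq_one hE
  obtain ⟨w, hw, rfl⟩ := exists_unit_span_of_finrank_eq_one hF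
  have hsq : ∀ a b : Plane, ‖a‖ = 1 → ‖b‖ = 1 →
      ‖b - inner ℝ a b • a‖ ^ 2 = 1 - inner ℝ a b ^ 2 := by
    intro a b ha hb
    rw [norm_sub_sq_real, norm_smul, inner_smul_right, real_inner_comm, ha, hb, mul_one,
      Real.norm_eq_abs, sq_abs]
    ring
  have hsymm : ‖u - inner ℝ w u • w‖ = ‖w - inner ℝ u w • u‖ := by
    rw [← sq_eq_sq₀ (norm_nonneg _) (norm_nonneg _), hsq _ _ hw hu, hsq _ _ hu hw,
      real_inner_comm]
  refine ⟨‖w - inner ℝ u w • u‖, ?_, ?_⟩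
  · rw [norm_pos_iff, sub_ne_zero]
    intro h
    have hwE : w ∈ ℝ ∙ u := Submodule.mem_span_singleton.2 ⟨_, h.symm⟩
    have hw0 := Submodule.disjoint_def.1 hEF w hwE (Submodule.mem_span_singleton_self w)
    simp [hw0] at hw
  · intro e he f hf
    obtain ⟨a, rfl⟩ := Submodule.mem_span_singleton.1 he
    obtain ⟨b, rfl⟩ := Submodule.mem_span_singleton.1 hf
    have h1 : a • u + b • w - inner ℝ u (a • u + b • w) • u = b • (w - inner ℝ u w • u) := by
      rw [inner_add_right, inner_smul_right, inner_smul_right, real_inner_self_eq_norm_sq, hu]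
      module
    have h2 : a • u + b • w - inner ℝ w (a • u + b • w) • w = a • (u - inner ℝ w u • w) := by
      rw [inner_add_right, inner_smul_right, inner_smul_right, real_inner_self_eq_norm_sq, hw]
      module
    rw [coneGap, Submodule.starProjection_unit_singleton ℝ hu,
      Submodule.starProjection_unit_singleton ℝ hw, h1, h2, norm_smul, norm_smul, norm_smul,
      norm_smul, hsymm, hu, hw]
    ring

lemma coneGap_smul (E F : Submodule ℝ Plane) {r : ℝ} (hr : 0 ≤ r) (v : Plane) :
    coneGap E F (r • v) = r * coneGap E F v := by
  rw [coneGap, coneGap, map_smul, map_smul, ← smul_sub, ← smul_sub, norm_smul, norm_smul,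
    Real.norm_of_nonneg hr, mul_sub]

lemma notMem_of_coneGap_nonneg {E F : Submodule ℝ Plane} (hE : Module.finrank ℝ E = 1)
    (hF : Module.finrank ℝ F = 1) (hEF : Disjoint E F) {v : Plane} (hv : v ≠ 0)
    (h : 0 ≤ coneGap E F v) : v ∉ E := by
  intro hvE
  obtain ⟨c, hc, hcone⟩ := exists_coneGap_add_eq hE hF hEF
  have h1 := hcone v hvE 0 F.zero_mem
  rw [add_zero, norm_zero] at h1
  have := mul_pos hc (norm_pos_iff.2 hv)
  linarith

lemma Continuous.coneGap {X Y : Type*} [TopologicalSpace X] [TopologicalSpace Y]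
    {E F : X → Submodule ℝ Plane} (hE : ContinuousSubspaces E) (hF : ContinuousSubspaces F)
    {g : Y → X} (hg : Continuous g) {m : Y → Plane} (hm : Continuous m) :
    Continuous fun q ↦ coneGap (E (g q)) (F (g q)) (m q) := by
  have h1 : Continuous fun q ↦ (E (g q)).starProjection := hE.comp hg
  have h2 : Continuous fun q ↦ (F (g q)).starProjection := hF.comp hg
  exact ((hm.sub (h1.clm_apply hm)).norm).sub ((hm.sub (h2.clm_apply hm)).norm)

/-! ### Robust invariance of the cone field -/

section Cone

variable {X : Type*} [TopologicalSpace X] {T : X ≃ₜ X} {A : X → GL (Fin 2) ℝ}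
  {E F : X → Submodule ℝ Plane}

/-- Domination maps the closed cone around `F` into the open one. -/
lemma IsDominatedSplitting.exists_coneGap_pos (h : IsDominatedSplitting T A E F) (x : X) :
    ∃ l : ℕ, 1 ≤ l ∧ ∀ v : Plane, v ≠ 0 → 0 ≤ coneGap (E x) (F x) v →
      0 < coneGap (E (T^[l] x)) (F (T^[l] x)) (planeMap (cocycleIter T A l x) v) := by
  obtain ⟨hc, hE, hF, -, -, l, hl, hdom⟩ := h.2.2 x
  refine ⟨l, hl, fun v hv hcone ↦ ?_⟩
  obtain ⟨e, he, f, hf, rfl⟩ := Submodule.mem_sup.1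
    (hc.sup_eq_top ▸ Submodule.mem_top : v ∈ E x ⊔ F x)
  obtain ⟨c, hc0, hc1⟩ := exists_coneGap_add_eq hE hF hc.disjoint
  obtain ⟨hc', hE', hF', -⟩ := h.2.2 (T^[l] x)
  obtain ⟨c', hc0', hc1'⟩ := exists_coneGap_add_eq hE' hF' hc'.disjoint
  set M := cocycleIter T A l x with hM
  have heM : planeMap M e ∈ E (T^[l] x) := map_cocycleIter T A (fun y ↦ (h.2.2 y).2.2.2.1) l he
  have hfM : planeMap M f ∈ F (T^[l] x) := map_cocycleIter T A (fun y ↦ (h.2.2 y).2.2.2.2.1) l hf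
  rw [hc1 e he f hf] at hcone
  have hef : ‖e‖ ≤ ‖f‖ := by
    have := nonneg_of_mul_nonneg_right hcone hc0
    linarith
  have hf0 : f ≠ 0 := by
    rintro rfl
    have : e = 0 := by simpa using hef
    exact hv (by simp [this])
  have hMf : 0 < ‖planeMap M f‖ := norm_pos_iff.2 (planeMap_ne_zero M hf0)
  rw [map_add, hc1' _ heM _ hfM]
  refine mul_pos hc0' (sub_pos.2 ?_)
  rw [cocycleIterNeg_iterate, ← hM] at hdom
  have h1 := norm_planeMap_le_restrictNorm M he
  have h2 := norm_planeMap_le_restrictNorm M⁻¹ hfM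
  rw [planeMap_inv_apply] at h2
  have ha : 0 ≤ restrictNorm M (E x) := restrictNorm_nonneg M (E x)
  set a := restrictNorm M (E x)
  set b := restrictNorm M⁻¹ (F (T^[l] x))
  calc ‖planeMap M e‖ ≤ a * ‖f‖ := h1.trans (mul_le_mul_of_nonneg_left hef ha)
    _ ≤ a * (b * ‖planeMap M f‖) := mul_le_mul_of_nonneg_left h2 ha
    _ = a * b * ‖planeMap M f‖ := by ring
    _ < ‖planeMap M f‖ := by nlinarith

/-- The cone field of a dominated splitting of `A_θ₀` is invariant, after a bounded time that
depends on the base point only, under all cocycles `A_θ` with `θ` close to `θ₀`. -/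
lemma IsDominatedSplitting.exists_uniform_cone_step [CompactSpace X] (hA : Continuous A) {θ₀ : ℝ}
    (h : IsDominatedSplitting T (rotatedCocycle A θ₀) E F) :
    ∃ V ∈ 𝓝 θ₀, ∃ L : ℕ, ∀ x, ∃ l : ℕ, 1 ≤ l ∧ l ≤ L ∧ ∀ θ ∈ V, ∀ v : Plane, v ≠ 0 →
      0 ≤ coneGap (E x) (F x) v →
      0 ≤ coneGap (E (T^[l] x)) (F (T^[l] x))
        (planeMap (cocycleIter T (rotatedCocycle A θ) l x) v) := by
  suffices H : ∃ V ∈ 𝓝 θ₀, ∃ L : ℕ, ∀ x ∈ (Set.univ : Set X), ∃ l : ℕ, 1 ≤ l ∧ l ≤ L ∧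
      ∀ θ ∈ V, ∀ v : Plane, v ≠ 0 → 0 ≤ coneGap (E x) (F x) v →
      0 ≤ coneGap (E (T^[l] x)) (F (T^[l] x))
        (planeMap (cocycleIter T (rotatedCocycle A θ) l x) v) by simpa using H
  refine isCompact_univ.induction_on ⟨Set.univ, univ_mem, 0, by simp⟩ ?_ ?_ ?_
  · rintro S S' hS ⟨V, hV, L, hL⟩
    exact ⟨V, hV, L, fun x hx ↦ hL x (hS hx)⟩
  · rintro S S' ⟨V, hV, L, hL⟩ ⟨V', hV', L', hL'⟩
    refine ⟨V ∩ V', inter_mem hV hV', max L L', fun x hx ↦ ?_⟩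
    rcases hx with hx | hx
    · obtain ⟨l, h1, h2, h3⟩ := hL x hx
      exact ⟨l, h1, h2.trans (le_max_left _ _), fun θ hθ ↦ h3 θ hθ.1⟩
    · obtain ⟨l, h1, h2, h3⟩ := hL' x hx
      exact ⟨l, h1, h2.trans (le_max_right _ _), fun θ hθ ↦ h3 θ hθ.2⟩
  · intro x _
    obtain ⟨l, hl, hpos⟩ := h.exists_coneGap_pos x
    have hev : ∀ᶠ p : X × ℝ in 𝓝 (x, θ₀), ∀ v ∈ Metric.sphere (0 : Plane) 1,
        coneGap (E p.1) (F p.1) v < 0 ∨ 0 < coneGap (E (T^[l] p.1)) (F (T^[l] p.1))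
          (planeMap (cocycleIter T (rotatedCocycle A p.2) l p.1) v) := by
      refine (isCompact_sphere (0 : Plane) 1).eventually_forall_of_forall_eventually
        fun v hv ↦ ?_
      have hc1 := Continuous.coneGap h.1 h.2.1 (continuous_fst.comp continuous_fst)
        (continuous_snd (X := X × ℝ) (Y := Plane))
      have hB := (continuous_planeMap_cocycleIter_rotatedCocycle T hA l).comp
        (continuous_fst (X := X × ℝ) (Y := Plane))
      have hc2 := Continuous.coneGap h.1 h.2.1
        ((T.continuous.iterate l).comp (continuous_fst.comp continuous_fst))
        (hB.clm_apply continuous_snd)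
      have e1 := hc1.tendsto ((x, θ₀), v)
      have e2 := hc2.tendsto ((x, θ₀), v)
      rcases lt_or_ge (coneGap (E x) (F x) v) 0 with hneg | hnn
      · exact (e1.eventually (Iio_mem_nhds hneg)).mono fun q hq ↦ Or.inl hq
      · have hv0 : v ≠ 0 := by rintro rfl; simp at hv
        exact (e2.eventually (Ioi_mem_nhds (hpos v hv0 hnn))).mono
          fun q hq ↦ Or.inr hq
    rw [nhds_prod_eq, eventually_prod_iff] at hev
    obtain ⟨pX, hpX, pθ, hpθ, hp⟩ := hev
    refine ⟨{y | pX y}, mem_nhdsWithin_of_mem_nhds hpX, {θ | pθ θ}, hpθ, l, fun y hy ↦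
      ⟨l, hl, le_rfl, fun θ hθ v hv hcone ↦ ?_⟩⟩
    -- The cone is homogeneous, so it suffices to look at unit vectors.
    have hvn : 0 < ‖v‖ := norm_pos_iff.2 hv
    have hunit : ‖v‖⁻¹ • v ∈ Metric.sphere (0 : Plane) 1 := by
      rw [mem_sphere_zero_iff_norm, norm_smul, norm_inv, norm_norm, inv_mul_cancel₀ hvn.ne']
    have hinv : 0 < ‖v‖⁻¹ := inv_pos.2 hvn
    have := hp hy hθ _ hunit
    rw [map_smul, coneGap_smul _ _ hinv.le, coneGap_smul _ _ hinv.le] at this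
    rcases this with hneg | hpos'
    · exact absurd hneg (not_lt.2 (mul_nonneg hinv.le hcone))
    · exact (pos_of_mul_pos_right hpos' hinv.le).le

end Cone

/-! ### Angles along an orbit -/

section AngleIter

variable {X : Type*} [TopologicalSpace X] (T : X ≃ₜ X) (a : X → ℝ → ℝ)

/-- The angle obtained from the angle `s` at the point `x` after `n` steps of the cocycle `A_θ`,
where `a y` is a lift of the action of `A y` on angles. -/
def angleIter : ℕ → X → ℝ → ℝ → ℝ
  | 0, _, _, s => s
  | n + 1, x, θ, s => a (T^[n] x) (angleIter n x θ s + θ)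

variable {T a} {A : X → GL (Fin 2) ℝ}

lemma continuous_angleIter (ha : ∀ y, IsAngleLift (A y) (a y)) (n : ℕ) (x : X) (s : ℝ) :
    Continuous fun θ ↦ angleIter T a n x θ s := by
  induction n with
  | zero => exact continuous_const
  | succ n ih => exact (ha _).continuous.comp (ih.add continuous_id)

lemma monotone_angleIter (ha : ∀ y, IsAngleLift (A y) (a y)) (n : ℕ) (x : X) (θ : ℝ) :
    Monotone (angleIter T a n x θ) := by
  induction n with
  | zero => exact monotone_id
  | succ n ih => exact (ha _).monotone.comp (ih.add_const θ)

lemma angleIter_add_pi (ha : ∀ y, IsAngleLift (A y) (a y)) (n : ℕ) (x : X) (θ s : ℝ) :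
    angleIter T a n x θ (s + Real.pi) = angleIter T a n x θ s + Real.pi := by
  induction n with
  | zero => rfl
  | succ n ih => rw [angleIter, ih, add_right_comm, (ha _).add_pi, angleIter]

/-- Turning the parameter by `π` adds a half-turn in every step. -/
lemma angleIter_param_pi (ha : ∀ y, IsAngleLift (A y) (a y)) (n : ℕ) (x : X) (s : ℝ) :
    angleIter T a n x Real.pi s = angleIter T a n x 0 s + n * Real.pi := by
  induction n with
  | zero => simp [angleIter]
  | succ n ih =>
    rw [angleIter, ih, (ha _).add_pi, (ha _).add_nat_mul_pi, angleIter]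
    push_cast
    ring_nf

lemma planeMap_cocycleIter_dir (ha : ∀ y, IsAngleLift (A y) (a y)) (n : ℕ) (x : X) (θ s : ℝ) :
    ∃ r : ℝ, 0 < r ∧ planeMap (cocycleIter T (rotatedCocycle A θ) n x) (dir s) =
      r • dir (angleIter T a n x θ s) := by
  induction n with
  | zero => exact ⟨1, one_pos, by simp [cocycleIter, angleIter, planeMap_one]⟩
  | succ n ih =>
    obtain ⟨r, hr, h⟩ := ih
    obtain ⟨r', hr', h'⟩ := (ha (T^[n] x)).apply_dir (angleIter T a n x θ s + θ)
    refine ⟨r * r', mul_pos hr hr', ?_⟩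
    rw [cocycleIter, planeMap_mul, h, map_smul, planeMap_rotatedCocycle_dir, h', smul_smul,
      angleIter]

lemma abs_angleIter_sub_le (ha : ∀ y, IsAngleLift (A y) (a y)) (n : ℕ) (x : X) (θ : ℝ)
    {s : ℝ} (hs : |s| ≤ Real.pi) :
    |angleIter T a n x θ s - angleIter T a n x θ 0| ≤ Real.pi := by
  have h1 := monotone_angleIter ha (T := T) n x θ (abs_le.1 hs).1
  have h2 := monotone_angleIter ha (T := T) n x θ (abs_le.1 hs).2
  have h3 := angleIter_add_pi ha (T := T) n x θ (-Real.pi)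
  have h4 := angleIter_add_pi ha (T := T) n x θ 0
  rw [neg_add_cancel] at h3
  rw [zero_add] at h4
  rw [abs_le]
  constructor <;> linarith

lemma abs_angleIter_sub_add_le (ha : ∀ y, IsAngleLift (A y) (a y)) (n k : ℕ) (x : X)
    (θ θ' s : ℝ) :
    |angleIter T a (n + k) x θ s - angleIter T a (n + k) x θ' s| ≤
      |angleIter T a n x θ s - angleIter T a n x θ' s| + k * (2 * Real.pi + |θ - θ'|) := by
  induction k with
  | zero => simp
  | succ k ih =>
    obtain ⟨c, hc⟩ := (ha (T^[n + k] x)).near_translation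
    rw [← add_assoc, angleIter, angleIter]
    set p := angleIter T a (n + k) x θ s
    set q := angleIter T a (n + k) x θ' s
    have h1 := hc (p + θ)
    have h2 := hc (q + θ')
    have h3 : |a (T^[n + k] x) (p + θ) - a (T^[n + k] x) (q + θ')| ≤
        |p - q| + |θ - θ'| + 2 * Real.pi := by
      rw [abs_le] at h1 h2 ⊢
      have := abs_le.1 (le_refl |p - q|)
      have := abs_le.1 (le_refl |θ - θ'|)
      constructor <;> linarith
    push_cast
    linarith

end AngleIter

/-- A continuous real function whose direction stays off a line oscillates by less than a
half-turn on an interval. -/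
lemma abs_sub_lt_pi_of_dir_notMem {E : Submodule ℝ Plane} (hE : Module.finrank ℝ E = 1)
    {g : ℝ → ℝ} {p q : ℝ} (hg : ContinuousOn g (Set.uIcc p q))
    (hmem : ∀ t ∈ Set.uIcc p q, dir (g t) ∉ E) : |g p - g q| < Real.pi := by
  obtain ⟨u, hu, rfl⟩ := exists_unit_span_of_finrank_eq_one hE
  obtain ⟨e, -, rfl⟩ := exists_dir_eq hu
  by_contra! hcon
  -- The interval between `g p` and `g q` contains a translate of `e` by a multiple of `π`.
  obtain ⟨k, hk⟩ : ∃ k : ℤ, e + k * Real.pi ∈ Set.uIcc (g p) (g q) := by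
    obtain ⟨k, hk, -⟩ := existsUnique_add_zsmul_mem_Ico Real.pi_pos e (min (g p) (g q))
    refine ⟨k, ?_⟩
    rw [zsmul_eq_mul] at hk
    refine ⟨hk.1, hk.2.le.trans ?_⟩
    have := max_sub_min_eq_abs (g p) (g q)
    rw [abs_sub_comm] at this
    change min (g p) (g q) + Real.pi ≤ max (g p) (g q)
    linarith
  obtain ⟨t, ht, hte⟩ := intermediate_value_uIcc hg hk
  apply hmem t ht
  rw [hte, dir_add_int_mul_pi]
  exact Submodule.smul_mem _ _ (Submodule.mem_span_singleton_self _)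

/-! ### Nearby parameters turn at the same rate -/

/-- Along every orbit, the angle iterates of a parameter `θ₀` of domination and of a nearby
parameter `θ` stay within bounded distance: at a set of times with bounded gaps, the image of the
line `F x` under `A_θ` lies in the cone around `F`, hence off the line `E`, for all parameters
between `θ₀` and `θ`. -/
lemma eventually_bounded_angleIter_sub {X : Type*} [TopologicalSpace X] [CompactSpace X]
    {T : X ≃ₜ X} {A : X → GL (Fin 2) ℝ} (hA : Continuous A) {a : X → ℝ → ℝ}
    (ha : ∀ y, IsAngleLift (A y) (a y)) {θ₀ : ℝ}
    (hdom : HasDominatedSplitting T (rotatedCocycle A θ₀)) (x : X) :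
    ∀ᶠ θ in 𝓝 θ₀, ∃ C : ℝ, ∀ n : ℕ,
      |angleIter T a n x θ₀ 0 - angleIter T a n x θ 0| ≤ C := by
  obtain ⟨E, F, hEF⟩ := hdom
  have hEF' : IsDominatedSplitting T (rotatedCocycle A θ₀) E F := hEF
  obtain ⟨V, hV, L, hstep⟩ := hEF'.exists_uniform_cone_step hA
  obtain ⟨δ, hδ, hball⟩ := Metric.mem_nhds_iff.1 hV
  obtain ⟨hc, hE, hF, -⟩ := hEF.2.2 x
  obtain ⟨v, hv, hFv⟩ := exists_unit_span_of_finrank_eq_one hF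
  obtain ⟨s, hs, rfl⟩ := exists_dir_eq hv
  have hstart : 0 ≤ coneGap (E x) (F x) (dir s) := by
    obtain ⟨c, hc0, hcone⟩ := exists_coneGap_add_eq hE hF hc.disjoint
    have hsF : dir s ∈ F x := hFv ▸ Submodule.mem_span_singleton_self _
    have := hcone 0 (E x).zero_mem (dir s) hsF
    rw [zero_add] at this
    rw [this, norm_zero, sub_zero]
    positivity
  have hvisit : ∀ n : ℕ, ∃ m ≤ n, n ≤ m + L ∧ ∀ θ ∈ V,
      0 ≤ coneGap (E (T^[m] x)) (F (T^[m] x))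
        (planeMap (cocycleIter T (rotatedCocycle A θ) m x) (dir s)) := by
    intro n
    induction n with
    | zero => exact ⟨0, le_rfl, Nat.zero_le _, fun θ _ ↦ by simpa [cocycleIter, planeMap_one]⟩
    | succ n ih =>
      obtain ⟨m, hmn, hnm, hm⟩ := ih
      obtain ⟨l, hl, hlL, hcone⟩ := hstep (T^[m] x)
      by_cases hle : m + l ≤ n + 1
      · refine ⟨m + l, hle, by omega, fun θ hθ ↦ ?_⟩
        have := hcone θ hθ _ (planeMap_ne_zero _ (dir_ne_zero s)) (hm θ hθ)
        rwa [← planeMap_mul, ← cocycleIter_add, ← Function.iterate_add_apply, add_comm l m] at this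
      · exact ⟨m, by omega, by omega, hm⟩
  filter_upwards [Metric.ball_mem_nhds θ₀ hδ] with θ hθ
  refine ⟨3 * Real.pi + L * (2 * Real.pi + |θ₀ - θ|), fun n ↦ ?_⟩
  obtain ⟨m, hmn, hnm, hm⟩ := hvisit n
  have hsub : Set.uIcc θ₀ θ ⊆ V := by
    refine subset_trans ?_ hball
    rw [Real.ball_eq_Ioo] at hθ ⊢
    exact Set.ordConnected_Ioo.uIcc_subset (by constructor <;> linarith) hθ
  obtain ⟨hcm, hEm, hFm, -⟩ := hEF.2.2 (T^[m] x)
  have hclose : |angleIter T a m x θ₀ s - angleIter T a m x θ s| < Real.pi := by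
    refine abs_sub_lt_pi_of_dir_notMem hEm (continuous_angleIter ha m x s).continuousOn
      fun t ht hmem ↦ ?_
    obtain ⟨r, -, hr⟩ := planeMap_cocycleIter_dir ha m x t s (T := T)
    refine notMem_of_coneGap_nonneg hEm hFm hcm.disjoint
      (planeMap_ne_zero (cocycleIter T (rotatedCocycle A t) m x) (dir_ne_zero s))
      (hm t (hsub ht)) ?_
    rw [hr]
    exact Submodule.smul_mem _ _ hmem
  have hgap := abs_angleIter_sub_add_le ha m (n - m) x θ₀ θ s (T := T)
  rw [Nat.add_sub_cancel' hmn] at hgap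
  have hnL : ((n - m : ℕ) : ℝ) ≤ L := by exact_mod_cast (by omega : n - m ≤ L)
  have hmul : ((n - m : ℕ) : ℝ) * (2 * Real.pi + |θ₀ - θ|) ≤ L * (2 * Real.pi + |θ₀ - θ|) :=
    mul_le_mul_of_nonneg_right hnL (by positivity)
  have h0 := abs_le.1 (abs_angleIter_sub_le ha n x θ₀ hs (T := T))
  have h1 := abs_le.1 (abs_angleIter_sub_le ha n x θ hs (T := T))
  have h2 := abs_le.1 (hgap.trans (add_le_add hclose.le hmul))
  rw [abs_le]
  constructor <;> linarith

/-- Here `det A > 0` is used to lift the action on directions to an orientation-preserving map. -/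
lemma exists_not_hasDominatedSplitting_rotatedCocycle {X : Type*} [TopologicalSpace X]
    [CompactSpace X] [Nonempty X] (T : X ≃ₜ X) {A : X → GL (Fin 2) ℝ} (hA : Continuous A)
    (hdet : ∀ x, 0 < (A x : Matrix (Fin 2) (Fin 2) ℝ).det) :
    ∃ θ : ℝ, ¬ HasDominatedSplitting T (rotatedCocycle A θ) := by
  by_contra! hall
  obtain ⟨x⟩ := ‹Nonempty X›
  choose a ha using fun y ↦ exists_isAngleLift (A y) (hdet y)
  -- Bounded distance of the angle iterates is an equivalence relation with open classes.
  obtain ⟨C, hC⟩ : ∃ C : ℝ, ∀ n : ℕ,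
      |angleIter T a n x 0 0 - angleIter T a n x Real.pi 0| ≤ C := by
    refine isPreconnected_univ.induction₂ (fun θ θ' : ℝ ↦ ∃ C : ℝ, ∀ n : ℕ,
      |angleIter T a n x θ 0 - angleIter T a n x θ' 0| ≤ C) ?_ ?_ ?_
      (Set.mem_univ 0) (Set.mem_univ Real.pi)
    · intro θ₀ _
      exact (eventually_bounded_angleIter_sub hA ha (hall θ₀) x).filter_mono nhdsWithin_le_nhds
    · rintro θ θ' θ'' - - - ⟨C, hC⟩ ⟨C', hC'⟩
      exact ⟨C + C', fun n ↦ (abs_sub_le _ _ _).trans (add_le_add (hC n) (hC' n))⟩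
    · rintro θ θ' - - ⟨C, hC⟩
      exact ⟨C, fun n ↦ abs_sub_comm (angleIter T a n x θ 0) _ ▸ hC n⟩
  obtain ⟨n, hn⟩ := exists_nat_gt (C / Real.pi)
  rw [div_lt_iff₀ Real.pi_pos] at hn
  have := neg_le_of_abs_le (hC n)
  rw [angleIter_param_pi ha] at this
  linarith

theorem mainTheorem3 {X : Type*} [MetricSpace X] [CompactSpace X]
    [MeasurableSpace X] [BorelSpace X]
    (T : X ≃ₜ X) (μ : MeasureTheory.Measure X) [MeasureTheory.IsProbabilityMeasure μ]
    (hμ : Ergodic T μ)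
    (A : X → GL (Fin 2) ℝ) (hA : Continuous A)
    (hdet : ∀ x, 0 < (A x : Matrix (Fin 2) (Fin 2) ℝ).det)
    (hdom : HasDominatedSplitting T A) :
    (Set.univ \ dominationSet T A).Nonempty ∧
      ∀ θ ∈ Set.univ \ dominationSet T A,
        ¬ HasDominatedSplitting T (rotatedCocycle A θ) := by
  have : Nonempty X := MeasureTheory.nonempty_of_isProbabilityMeasure μ
  obtain ⟨θ, hθ⟩ := exists_not_hasDominatedSplitting_rotatedCocycle T hA hdet
  exact ⟨⟨θ, Set.mem_univ θ, hθ⟩, fun θ' hθ' ↦ hθ'.2⟩
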